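/- Graphs are finite, simple and undirected. A colouring $\psi$ of the vertices of a graph $G$ is \emph{nonrepetitive} if there is no path $v_1,v_2,\dots,v_{2t}$ in $G$ (with $t\geq 1$ and distinct vertices) such that $\psi(v_i)=\psi(v_{t+i})$ for all $i\in\{1,\dots,t\}$. The graph $G$ is \emph{nonrepetitively $k$-choosable} if, for every assignment of a set $L(v)$ of colours to each vertex $v$ with $|L(v)|\geq k$ for all $v$, there is a nonrepetitive colouring $\psi$ of $G$ with $\psi(v)\in L(v)$ for every vertex $v$. The \emph{nonrepetitive choice number} $\pi_{\mathrm{ch}}(G)$ is the minimum integer $k\geq 0$ such that $G$ is nonrepetitively $k$-choosable. \textbf{Theorem.} For every graph $G$ with maximum degree $\Delta>1$, $$\pi_{\mathrm{ch}}(G)\leq\left\lceil\left(1+\frac{1}{\Delta^{1/3}-1}+\frac{1}{\Delta^{1/3}}\right)\Delta^2\right\rceil .$$ Consequently $\pi_{\mathrm{ch}}(G)\leq(1+o(1))\Delta^2$; that is, there is a function $\varepsilon:\mathbb{N}\to\mathbb{R}$ with $\varepsilon(\Delta)\to 0$ as $\Delta\to\infty$ such that $\pi_{\mathrm{ch}}(G)\leq(1+\varepsilon(\Delta))\Delta^2$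 for every graph $G$ with maximum degree $\Delta\geq 1$. -/

import Mathlib

open Filter Topology

universe u w

namespace SimpleGraph

/-- The path `v_1, …, v_{2t}` of `G` (with `t ≥ 1`, so that it has `2t` vertices and `2t - 1` edges)
is repetitively coloured by `φ`: `φ (v_i) = φ (v_{t+i})` for all `i ∈ [1, t]`.
(`p.getVert` numbers the vertices of the path from `0`.) -/
def RepetitivelyColoured {V : Type*} {C : Type*} (G : SimpleGraph V) (φ : V → C)
    {x y : V} (p : G.Walk x y) : Prop :=
  p.IsPath ∧ ∃ t : ℕ, 1 ≤ t ∧ p.length + 1 = 2 * t ∧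
    ∀ i < t, φ (p.getVert i) = φ (p.getVert (t + i))

/-- A colouring is nonrepetitive if no path of `G` is repetitively coloured by it. -/
def IsNonrepetitive {V : Type*} {C : Type*} (G : SimpleGraph V) (φ : V → C) : Prop :=
  ∀ (x y : V) (p : G.Walk x y), ¬ G.RepetitivelyColoured φ p

/-- `G` is nonrepetitively `L`-colourable: some nonrepetitive colouring takes the colour of
every vertex `v` from `L v`. -/
def NonrepetitivelyListColourable {V : Type*} {C : Type*} (G : SimpleGraph V)
    (L : V → Set C) : Prop :=
  ∃ φ : V → C, (∀ v, φ v ∈ L v) ∧ G.IsNonrepetitive φ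

/-- `G` is nonrepetitively `k`-choosable: for every set `C` of colours and every list assignment
`L` with at least `k` colours in each list, `G` is nonrepetitively `L`-colourable. -/
def NonrepetitivelyChoosable {V : Type u} (G : SimpleGraph V) (k : ℕ) : Prop :=
  ∀ (C : Type w) (L : V → Set C), (∀ v, (k : ℕ∞) ≤ (L v).encard) →
    G.NonrepetitivelyListColourable L

/-- The nonrepetitive choice number: the least `k` such that `G` is nonrepetitively
`k`-choosable (and `⊤` if there is no such `k`). -/
noncomputable def nonrepetitiveChoiceNumber {V : Type u} (G : SimpleGraph V) : ℕ∞ :=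
  ⨅ k ∈ {k : ℕ | NonrepetitivelyChoosable.{u, w} G k}, (k : ℕ∞)

end SimpleGraph

/-!
Fix lists of `k` colours and let `N S` be the number of nonrepetitive list colourings of the
subgraph induced by `S`. The proof is a counting argument: for a suitable `β > 0`, adding a vertex
multiplies the number of colourings by at least `β`, that is `β * N (S \ {v}) ≤ N S`
(`mul_card_listColourings_erase_le_card`). Since `N ∅ = 1`, the whole graph then has a
nonrepetitive colouring.

The growth estimate is proved by strong induction on `S`. Of the `k * N (S \ {v})` ways to extend a
colouring of `S \ {v}` to `v`, those that fail create a repetition on a path through `v` with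
`2 * (s + 1)` vertices, for some `s`. Reversing the path if necessary, `v` is one of the `s + 1`
vertices of the first half, so with `Δ` the maximum degree there are at most
`(s + 1) * Δ ^ (2 * s + 1)` such paths (`card_walkSequences_le`). The colours on the first half of
a repetition are determined by the second half, so for a given path there are at most
`N (S \ half)` failures (`card_filter_isRepetition_le`), which is at most `N (S \ {v}) / β ^ s` by
the induction hypothesis. Hence it is enough that
`β + ∑ s, (s + 1) * Δ ^ (2 * s + 1) / β ^ s ≤ k`.

With `β = r * Δ ^ 2` the sum is bounded by the series `Δ * ∑ (s + 1) / r ^ s`, whose value is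
`Δ * (r / (r - 1)) ^ 2`. Choosing `r = 1 + 1 / (Δ ^ (1 / 3) - 1)` makes `r / (r - 1)` equal to
`Δ ^ (1 / 3)`, and the requirement becomes
`(1 + 1 / (Δ ^ (1 / 3) - 1) + 1 / Δ ^ (1 / 3)) * Δ ^ 2 ≤ k`. For `Δ = 1` the choice `r = 2` gives
`k = 6`, which only affects a single value of the error function.
-/

namespace SimpleGraph

open Finset

/-! ### Walks through a vertex at a given position -/

section Walks

variable {V : Type*} [Fintype V] (G : SimpleGraph V)

open Classical in
/-- The vertex sequences of the walks of length `n` in `G` whose `i`-th vertex is `v`. -/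
noncomputable def walkSequences (n : ℕ) (i : Fin (n + 1)) (v : V) : Finset (Fin (n + 1) → V) :=
  {f | (∀ j : Fin n, G.Adj (f j.castSucc) (f j.succ)) ∧ f i = v}

variable {G} in
theorem mem_walkSequences {n : ℕ} {i : Fin (n + 1)} {v : V} {f : Fin (n + 1) → V} :
    f ∈ G.walkSequences n i v ↔ (∀ j : Fin n, G.Adj (f j.castSucc) (f j.succ)) ∧ f i = v := by
  classical
  simp only [walkSequences, mem_filter, mem_univ, true_and]

theorem card_walkSequences_le [DecidableRel G.Adj] (n : ℕ) (i : Fin (n + 1)) (v : V) :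
    #(G.walkSequences n i v) ≤ G.maxDegree ^ n := by
  classical
  induction n with
  | zero =>
    rw [pow_zero, Finset.card_le_one]
    intro f hf g hg
    rw [mem_walkSequences] at hf hg
    ext j
    rw [Fin.fin_one_eq_zero j, ← Fin.fin_one_eq_zero i, hf.2, hg.2]
  | succ n ih =>
    rcases Fin.eq_zero_or_eq_succ i with rfl | ⟨i, rfl⟩
    -- Drop the last vertex, which is a neighbour of the one before it.
    · rw [pow_succ']
      refine (card_le_mul_card_image_of_maps_to (f := fun f => Fin.init f)
        (t := G.walkSequences n 0 v) ?_ G.maxDegree ?_).trans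
        (Nat.mul_le_mul_left _ (ih 0))
      · intro f hf
        rw [mem_walkSequences] at hf ⊢
        exact ⟨fun j => hf.1 j.castSucc, hf.2⟩
      · intro g hg
        refine le_trans ?_ (G.degree_le_maxDegree (g (Fin.last n)))
        rw [← card_neighborFinset_eq_degree]
        refine card_le_card_of_injOn (fun f => f (Fin.last _)) ?_ ?_
        · intro f hf
          rw [mem_coe, mem_filter, mem_walkSequences] at hf
          obtain ⟨hf, rfl⟩ := hf
          exact (G.mem_neighborFinset _ _).2 (hf.1 (Fin.last n))
        · intro f hf f' hf' h
          simp only [coe_filter, Set.mem_ofPred_eq] at hf hf'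
          rw [← Fin.snoc_init_self f, ← Fin.snoc_init_self f', hf.2, hf'.2]
          exact congrArg _ h
    -- Drop the first vertex, which is a neighbour of the second.
    · rw [pow_succ']
      refine (card_le_mul_card_image_of_maps_to (f := fun f => Fin.tail f)
        (t := G.walkSequences n i v) ?_ G.maxDegree ?_).trans
        (Nat.mul_le_mul_left _ (ih i))
      · intro f hf
        rw [mem_walkSequences] at hf ⊢
        exact ⟨fun j => hf.1 j.succ, hf.2⟩
      · intro g hg
        refine le_trans ?_ (G.degree_le_maxDegree (g 0))
        rw [← card_neighborFinset_eq_degree]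
        refine card_le_card_of_injOn (fun f => f 0) ?_ ?_
        · intro f hf
          rw [mem_coe, mem_filter, mem_walkSequences] at hf
          obtain ⟨hf, rfl⟩ := hf
          exact (G.mem_neighborFinset _ _).2 (hf.1 0).symm
        · intro f hf f' hf' h
          simp only [coe_filter, Set.mem_ofPred_eq] at hf hf'
          rw [← Fin.cons_self_tail f, ← Fin.cons_self_tail f', hf.2, hf'.2]
          exact congrArg (fun x => Fin.cons (α := fun _ => V) x g) h

end Walks

/-! ### Repetitively coloured paths as vertex sequences -/

section Repetitions

variable {V C : Type*} (G : SimpleGraph V)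

/-- The sequence `f` of `2 * (s + 1)` vertices is a path of `G` inside `S` that `φ` colours
repetitively. Writing the half-length as `s + 1` builds in that it is positive. -/
structure IsRepetition (φ : V → C) (S : Finset V) (s : ℕ) (f : Fin (2 * s + 1 + 1) → V) :
    Prop where
  injective : Function.Injective f
  adj : ∀ j : Fin (2 * s + 1), G.Adj (f j.castSucc) (f j.succ)
  mem : ∀ j, f j ∈ S
  eq : ∀ (j : ℕ) (hj : j < s + 1), φ (f ⟨j, by lia⟩) = φ (f ⟨s + 1 + j, by lia⟩)

variable {G} {φ : V → C} {S : Finset V} {s : ℕ} {f : Fin (2 * s + 1 + 1) → V}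

theorem IsRepetition.reverse (h : G.IsRepetition φ S s f) :
    G.IsRepetition φ S s (f ∘ Fin.rev) where
  injective := h.injective.comp Fin.rev_injective
  adj j := by
    have := (h.adj j.rev).symm
    rwa [← Fin.rev_castSucc, ← Fin.rev_succ] at this
  mem j := h.mem _
  eq j hj := by
    have := (h.eq (s - j) (by lia)).symm
    simp only [Function.comp_apply]
    convert this using 3 <;> ext <;> simp [Fin.val_rev] <;> lia

theorem IsRepetition.congr {φ' : V → C} {T : Finset V} (h : G.IsRepetition φ S s f)
    (hT : ∀ j, f j ∈ T) (hφ : ∀ u ∈ T, φ' u = φ u) : G.IsRepetition φ' T s f where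
  injective := h.injective
  adj := h.adj
  mem := hT
  eq j hj := by rw [hφ _ (hT _), hφ _ (hT _), h.eq j hj]

/-- Since a path may be reversed, a given vertex of a repetition may be assumed to lie in its
first half. -/
theorem IsRepetition.exists_mem_first_half {v : V} (h : G.IsRepetition φ S s f)
    (hv : v ∈ Set.range f) :
    ∃ g, G.IsRepetition φ S s g ∧ ∃ i : Fin (s + 1), g (i.castLE (by lia)) = v := by
  obtain ⟨i, rfl⟩ := hv
  by_cases hi : i.val < s + 1
  · exact ⟨f, h, ⟨i, hi⟩, rfl⟩
  · refine ⟨_, h.reverse, ⟨2 * s + 1 - i, by lia⟩, congrArg f ?_⟩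
    ext
    simp [Fin.val_rev]
    lia

theorem RepetitivelyColoured.exists_isRepetition [Fintype V] {x y : V} {p : G.Walk x y}
    (h : G.RepetitivelyColoured φ p) : ∃ s f, G.IsRepetition φ univ s f := by
  obtain ⟨hp, t, ht, hlen, heq⟩ := h
  obtain ⟨s, rfl⟩ := Nat.exists_eq_add_of_le' ht
  refine ⟨s, fun j => p.getVert j, ?_, ?_, fun _ => mem_univ _, fun j hj => heq j hj⟩
  · intro a b hab
    exact Fin.ext (hp.getVert_injOn (by simp; lia) (by simp; lia) hab)
  · intro j
    exact p.adj_getVert_succ (by rw [Fin.val_castSucc]; lia)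

end Repetitions

/-! ### Counting nonrepetitive list colourings -/

open Classical in
/-- Iterating a growth rate of `β` per added vertex. -/
theorem pow_card_sdiff_mul_le {V : Type*} {N : Finset V → ℝ} {β : ℝ} (hβ : 0 ≤ β) {U : Finset V}
    (hN : ∀ S ⊆ U, ∀ v ∈ S, β * N (S.erase v) ≤ N S) {T : Finset V} (hT : T ⊆ U) :
    β ^ #(U \ T) * N T ≤ N U := by
  induction h : #(U \ T) generalizing U with
  | zero =>
    have : U ⊆ T := sdiff_eq_empty_iff_subset.1 (card_eq_zero.1 h)
    simp [hT.antisymm this]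
  | succ n ih =>
    obtain ⟨v, hv⟩ := card_pos.1 (by rw [h]; exact n.succ_pos)
    rw [Finset.mem_sdiff] at hv
    have h' : #(U.erase v \ T) = n := by
      rw [erase_sdiff_comm, card_erase_of_mem (Finset.mem_sdiff.2 hv), h, Nat.add_sub_cancel]
    have := ih (fun S hS => hN S (hS.trans (erase_subset _ _)))
      (subset_erase.2 ⟨hT, hv.2⟩) h'
    calc β ^ (n + 1) * N T = β * (β ^ n * N T) := by ring
      _ ≤ β * N (U.erase v) := by gcongr
      _ ≤ N U := hN U subset_rfl v hv.1

section Counting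

variable {V C : Type*} [Fintype V] (G : SimpleGraph V) (L : V → Finset C) (c : V → C)

open Classical in
/-- The nonrepetitive `L`-colourings of the subgraph of `G` induced by `S`, encoded as functions
on all of `V` by giving every vertex `u` outside `S` the dummy colour `c u`. -/
noncomputable def listColourings (S : Finset V) : Finset (V → C) :=
  {φ ∈ Fintype.piFinset fun u => if u ∈ S then L u else {c u} |
    ∀ s f, ¬ G.IsRepetition φ S s f}

open Classical in
/-- The `L`-colourings of `S` that are nonrepetitive away from the vertex `v`. -/
noncomputable def listColouringsAwayFrom (S : Finset V) (v : V) : Finset (V → C) :=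
  {φ ∈ Fintype.piFinset fun u => if u ∈ S then L u else {c u} |
    ∀ s f, ¬ G.IsRepetition φ (S.erase v) s f}

variable {G L c} {S : Finset V} {v : V} {φ : V → C}

theorem mem_listColourings : φ ∈ G.listColourings L c S ↔
    (∀ u ∈ S, φ u ∈ L u) ∧ (∀ u ∉ S, φ u = c u) ∧ ∀ s f, ¬ G.IsRepetition φ S s f := by
  classical
  simp only [listColourings, mem_filter, Fintype.mem_piFinset, ← and_assoc]
  refine and_congr_left fun _ => ⟨fun h => ⟨fun u hu => ?_, fun u hu => ?_⟩, fun h u => ?_⟩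
  · simpa [hu] using h u
  · simpa [hu] using h u
  · by_cases hu : u ∈ S
    · simpa [hu] using h.1 u hu
    · simpa [hu] using h.2 u hu

open Classical in
theorem mem_listColouringsAwayFrom : φ ∈ G.listColouringsAwayFrom L c S v ↔
    (∀ u ∈ S, φ u ∈ L u) ∧ (∀ u ∉ S, φ u = c u) ∧
      ∀ s f, ¬ G.IsRepetition φ (S.erase v) s f := by
  simp only [listColouringsAwayFrom, mem_filter, Fintype.mem_piFinset, ← and_assoc]
  refine and_congr_left fun _ => ⟨fun h => ⟨fun u hu => ?_, fun u hu => ?_⟩, fun h u => ?_⟩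
  · simpa [hu] using h u
  · simpa [hu] using h u
  · by_cases hu : u ∈ S
    · simpa [hu] using h.1 u hu
    · simpa [hu] using h.2 u hu

open Classical in
theorem mul_card_listColourings_erase_le (hv : v ∈ S) :
    #(L v) * #(G.listColourings L c (S.erase v)) ≤ #(G.listColouringsAwayFrom L c S v) := by
  rw [mul_comm, ← card_product]
  refine card_le_card_of_injOn (fun q => Function.update q.1 v q.2) ?_ ?_
  · rintro ⟨φ, a⟩ h
    simp only [coe_product, Set.mem_prod, mem_coe, mem_listColourings, mem_erase] at h
    obtain ⟨⟨h₁, h₂, h₃⟩, ha⟩ := h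
    rw [mem_coe, mem_listColouringsAwayFrom]
    refine ⟨fun u hu => ?_, fun u hu => ?_, fun s f hf => ?_⟩
    · by_cases huv : u = v
      · subst huv; simpa using ha
      · simpa [huv] using h₁ u ⟨huv, hu⟩
    · have huv : u ≠ v := fun h => hu (h ▸ hv)
      simpa [huv] using h₂ u (by simp [hu])
    · refine h₃ s f (hf.congr hf.mem fun u hu => ?_)
      simp [ne_of_mem_erase hu]
  · rintro ⟨φ, a⟩ h ⟨φ', a'⟩ h' heq
    simp only [coe_product, Set.mem_prod, mem_coe, mem_listColourings] at h h'
    have hφ : φ = φ' := by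
      ext u
      by_cases huv : u = v
      · rw [huv, h.1.2.1 v (by simp), h'.1.2.1 v (by simp)]
      · simpa [huv] using congrFun heq u
    have ha : a = a' := by simpa using congrFun heq v
    rw [hφ, ha]

open Classical in
/-- A colouring that is nonrepetitive away from `v` and repeats on `f` is determined by its
restriction to the complement of the first half of `f`, and that restriction is nonrepetitive
as soon as `v` lies in the first half. -/
theorem card_filter_isRepetition_le {s : ℕ} (f : Fin (2 * s + 1 + 1) → V) (i : Fin (s + 1))
    (hi : f (i.castLE (by lia)) = v) :
    #{φ ∈ G.listColouringsAwayFrom L c S v | G.IsRepetition φ S s f} ≤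
      #(G.listColourings L c
        (S \ univ.image fun j : Fin (s + 1) => f (j.castLE (by lia)))) := by
  set H := univ.image fun j : Fin (s + 1) => f (j.castLE (by lia)) with hH
  have hvH : v ∈ H := mem_image.2 ⟨i, mem_univ _, hi⟩
  refine card_le_card_of_injOn (fun φ => (S \ H).piecewise φ c) ?_ ?_
  · intro φ hφ
    rw [mem_coe, mem_filter, mem_listColouringsAwayFrom] at hφ
    obtain ⟨⟨h₁, h₂, h₃⟩, -⟩ := hφ
    rw [mem_coe, mem_listColourings]
    refine ⟨fun u hu => ?_, fun u hu => by simp only [piecewise_eq_of_notMem _ _ _ hu],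
      fun s' g hg => h₃ s' g ?_⟩
    · simp only [piecewise_eq_of_mem _ _ _ hu]
      exact h₁ u (Finset.mem_sdiff.1 hu).1
    · have hg' : G.IsRepetition φ (S \ H) s' g :=
        hg.congr hg.mem fun u hu => (piecewise_eq_of_mem _ _ _ hu).symm
      refine hg'.congr (fun j => ?_) fun _ _ => rfl
      have := Finset.mem_sdiff.1 (hg.mem j)
      exact mem_erase.2 ⟨fun h => this.2 (h ▸ hvH), this.1⟩
  · intro φ hφ φ' hφ' heq
    rw [mem_coe, mem_filter, mem_listColouringsAwayFrom] at hφ hφ'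
    obtain ⟨⟨-, h₂, -⟩, hf⟩ := hφ
    obtain ⟨⟨-, h₂', -⟩, hf'⟩ := hφ'
    have hout : ∀ u ∈ S \ H, φ u = φ' u := fun u hu => by
      simpa only [piecewise_eq_of_mem _ _ _ hu] using congrFun heq u
    ext u
    by_cases hu : u ∈ S
    · by_cases huH : u ∈ H
      · obtain ⟨j, -, rfl⟩ := mem_image.1 huH
        have e := hf.eq j j.2
        have e' := hf'.eq j j.2
        refine e.trans ((hout _ (Finset.mem_sdiff.2 ⟨hf.mem _, fun hmem => ?_⟩)).trans e'.symm)
        obtain ⟨j', -, hj'⟩ := mem_image.1 hmem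
        have := congrArg Fin.val (hf.injective hj')
        simp at this
        lia
      · exact hout u (Finset.mem_sdiff.2 ⟨hu, huH⟩)
    · rw [h₂ u hu, h₂' u hu]

open Classical in
/-- Every colouring that is nonrepetitive away from `v` either is nonrepetitive or repeats on a
path with `v` in its first half. -/
theorem card_listColouringsAwayFrom_le :
    #(G.listColouringsAwayFrom L c S v) ≤ #(G.listColourings L c S) +
      ∑ s ∈ range (Fintype.card V), ∑ i : Fin (s + 1),
        ∑ f ∈ G.walkSequences (2 * s + 1) (i.castLE (by lia)) v,
          #{φ ∈ G.listColouringsAwayFrom L c S v | G.IsRepetition φ S s f} := by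
  have hsub : G.listColouringsAwayFrom L c S v ⊆ G.listColourings L c S ∪
      (range (Fintype.card V)).biUnion fun s => univ.biUnion fun i : Fin (s + 1) =>
        (G.walkSequences (2 * s + 1) (i.castLE (by lia)) v).biUnion fun f =>
          {φ ∈ G.listColouringsAwayFrom L c S v | G.IsRepetition φ S s f} := by
    intro φ hφ
    by_cases hφS : φ ∈ G.listColourings L c S
    · exact mem_union_left _ hφS
    refine mem_union_right _ ?_
    have h := mem_listColouringsAwayFrom.1 hφ
    obtain ⟨s, f, hf⟩ : ∃ s f, G.IsRepetition φ S s f := by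
      by_contra! hno
      exact hφS (mem_listColourings.2 ⟨h.1, h.2.1, hno⟩)
    have hv : v ∈ Set.range f := by
      by_contra hv
      exact h.2.2 s f (hf.congr
        (fun j => mem_erase.2 ⟨fun hj => hv ⟨j, hj⟩, hf.mem j⟩) fun _ _ => rfl)
    obtain ⟨g, hg, i, hi⟩ := hf.exists_mem_first_half hv
    have hs : s < Fintype.card V := by
      have := Fintype.card_le_of_injective g hg.injective
      rw [Fintype.card_fin] at this
      lia
    simp only [mem_biUnion, mem_filter, mem_range]
    exact ⟨s, hs, i, mem_univ _, g,
      mem_walkSequences.2 ⟨hg.adj, hi⟩, hφ, hg⟩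
  refine (card_le_card hsub).trans ((card_union_le _ _).trans (Nat.add_le_add_left ?_ _))
  exact card_biUnion_le.trans (sum_le_sum fun s _ =>
    card_biUnion_le.trans (sum_le_sum fun i _ => card_biUnion_le))

open Classical in
/-- Adding a vertex multiplies the number of nonrepetitive list colourings by at least `β`,
provided that the lists are large enough to absorb the colourings lost to repetitions. -/
theorem mul_card_listColourings_erase_le_card [DecidableRel G.Adj] {k : ℕ} {β : ℝ} (hβ : 0 < β)
    (hL : ∀ v, #(L v) = k)
    (hk : β + ∑ s ∈ range (Fintype.card V),
      (s + 1) * ((G.maxDegree : ℝ) ^ (2 * s + 1) / β ^ s) ≤ k)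
    (S : Finset V) : ∀ v ∈ S,
      β * #(G.listColourings L c (S.erase v)) ≤ (#(G.listColourings L c S) : ℝ) := by
  induction S using Finset.strongInduction with
  | H S ih =>
    intro v hv
    set M : ℝ := (#(G.listColourings L c (S.erase v)) : ℝ) with hM
    have hbad : ∀ (s : ℕ) (i : Fin (s + 1)),
        ∀ f ∈ G.walkSequences (2 * s + 1) (i.castLE (by lia)) v,
        (#{φ ∈ G.listColouringsAwayFrom L c S v | G.IsRepetition φ S s f} : ℝ) ≤ M / β ^ s := by
      intro s i f hf
      rcases Finset.eq_empty_or_nonempty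
        {φ ∈ G.listColouringsAwayFrom L c S v | G.IsRepetition φ S s f} with hemp | ⟨φ, hφ⟩
      · rw [hemp, card_empty, Nat.cast_zero]
        positivity
      have hrep : G.IsRepetition φ S s f := (mem_filter.1 hφ).2
      have hi : f (i.castLE (by lia)) = v := (mem_walkSequences.1 hf).2
      -- Erasing the half of the path that contains `v` costs `s` vertices besides `v`, so the
      -- induction hypothesis gains a factor `β ^ s`.
      have hle := card_filter_isRepetition_le (G := G) (L := L) (c := c) (S := S) f i hi
      set H := univ.image fun j : Fin (s + 1) => f (j.castLE (by lia)) with hH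
      have hvH : v ∈ H := mem_image.2 ⟨i, mem_univ _, hi⟩
      have hHS : H ⊆ S := by
        intro u hu
        obtain ⟨j, -, rfl⟩ := mem_image.1 hu
        exact hrep.mem _
      have hcardH : #H = s + 1 := by
        rw [hH, card_image_of_injective, card_univ, Fintype.card_fin]
        exact hrep.injective.comp (Fin.castLE_injective _)
      have hsub : S \ H ⊆ S.erase v :=
        fun u hu => mem_erase.2
          ⟨fun h => (Finset.mem_sdiff.1 hu).2 (h ▸ hvH), (Finset.mem_sdiff.1 hu).1⟩
      have hcard : #(S.erase v \ (S \ H)) = s := by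
        rw [erase_sdiff_comm, Finset.sdiff_sdiff_eq_self hHS, card_erase_of_mem hvH, hcardH,
          Nat.add_sub_cancel]
      have := pow_card_sdiff_mul_le (N := fun T => (#(G.listColourings L c T) : ℝ)) hβ.le
        (fun T hT => ih T (hT.trans_ssubset (erase_ssubset hv))) hsub
      rw [hcard] at this
      rw [le_div_iff₀' (by positivity)]
      refine le_trans ?_ this
      gcongr
    have hloss : (∑ s ∈ range (Fintype.card V), ∑ i : Fin (s + 1),
        ∑ f ∈ G.walkSequences (2 * s + 1) (i.castLE (by lia)) v,
          (#{φ ∈ G.listColouringsAwayFrom L c S v | G.IsRepetition φ S s f} : ℝ)) ≤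
        (∑ s ∈ range (Fintype.card V),
          (s + 1) * ((G.maxDegree : ℝ) ^ (2 * s + 1) / β ^ s)) * M := by
      rw [sum_mul]
      refine sum_le_sum fun s _ => ?_
      have : ∀ i : Fin (s + 1), ∑ f ∈ G.walkSequences (2 * s + 1) (i.castLE (by lia)) v,
          (#{φ ∈ G.listColouringsAwayFrom L c S v | G.IsRepetition φ S s f} : ℝ) ≤
          (G.maxDegree : ℝ) ^ (2 * s + 1) * (M / β ^ s) := fun i => by
        refine (sum_le_sum (hbad s i)).trans ?_
        rw [sum_const, nsmul_eq_mul]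
        gcongr
        exact_mod_cast G.card_walkSequences_le _ _ v
      refine (sum_le_sum fun i _ => this i).trans (le_of_eq ?_)
      rw [sum_const, card_univ, Fintype.card_fin, nsmul_eq_mul]
      push_cast
      ring
    have h₁ : (k : ℝ) * M ≤ #(G.listColouringsAwayFrom L c S v) := by
      rw [← hL v, hM]
      exact_mod_cast mul_card_listColourings_erase_le hv
    have h₂ : (#(G.listColouringsAwayFrom L c S v) : ℝ) ≤ #(G.listColourings L c S) +
        ∑ s ∈ range (Fintype.card V), ∑ i : Fin (s + 1),
        ∑ f ∈ G.walkSequences (2 * s + 1) (i.castLE (by lia)) v,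
          (#{φ ∈ G.listColouringsAwayFrom L c S v | G.IsRepetition φ S s f} : ℝ) := by
      exact_mod_cast card_listColouringsAwayFrom_le
    have h₃ := mul_le_mul_of_nonneg_right hk (by positivity : 0 ≤ M)
    linarith

end Counting

/-! ### Bounds on the nonrepetitive choice number -/

section ChoiceNumber

variable {V : Type u} {G : SimpleGraph V}

theorem NonrepetitivelyChoosable.nonrepetitiveChoiceNumber_le {k : ℕ}
    (h : NonrepetitivelyChoosable.{u, w} G k) :
    nonrepetitiveChoiceNumber.{u, w} G ≤ k :=
  iInf₂_le k h

variable [Fintype V] [DecidableRel G.Adj]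

/-- The empty set has one colouring, so a positive growth rate `β` leaves at least
`β ^ |V|`, hence a positive number of, nonrepetitive colourings of the whole graph. -/
theorem nonrepetitivelyChoosable_of_sum_le {k : ℕ} {β : ℝ} (hβ : 0 < β)
    (hk : β + ∑ s ∈ range (Fintype.card V),
      (s + 1) * ((G.maxDegree : ℝ) ^ (2 * s + 1) / β ^ s) ≤ k) :
    NonrepetitivelyChoosable.{u, w} G k := by
  classical
  intro C L hL
  have hk0 : k ≠ 0 := by
    rintro rfl
    have : 0 ≤ ∑ s ∈ range (Fintype.card V),
        ((s : ℝ) + 1) * ((G.maxDegree : ℝ) ^ (2 * s + 1) / β ^ s) :=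
      sum_nonneg fun s _ => by positivity
    rw [Nat.cast_zero] at hk
    linarith
  have hfin : ∀ v, ∃ A : Finset C, (A : Set C) ⊆ L v ∧ #A = k := fun v => by
    obtain ⟨A, hA, hcard⟩ := Set.exists_subset_encard_eq (hL v)
    lift A to Finset C using Set.finite_of_encard_eq_coe hcard
    exact ⟨A, hA, by simpa using hcard⟩
  -- Lists are cut down to exactly `k` colours, so that colourings can be counted.
  choose A hAL hA using hfin
  have hne : ∀ v, ∃ a, a ∈ A v := fun v => card_pos.1 (by rw [hA v]; lia)
  choose c hc using hne
  have hgrow := pow_card_sdiff_mul_le (N := fun T => (#(G.listColourings A c T) : ℝ)) hβ.le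
    (fun S _ => mul_card_listColourings_erase_le_card hβ hA hk S) (empty_subset (univ : Finset V))
  have hempty : c ∈ G.listColourings A c ∅ :=
    mem_listColourings.2 ⟨by simp, by simp, fun s f hf => by simpa using hf.mem 0⟩
  have hpos : (0 : ℝ) < #(G.listColourings A c univ) := by
    refine lt_of_lt_of_le (mul_pos (by positivity) ?_) hgrow
    exact_mod_cast card_pos.2 ⟨c, hempty⟩
  obtain ⟨φ, hφ⟩ := card_pos.1 (by exact_mod_cast hpos)
  rw [mem_listColourings] at hφ
  refine ⟨φ, fun v => hAL v (hφ.1 v (mem_univ v)), fun x y p hp => ?_⟩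
  obtain ⟨s, f, hf⟩ := hp.exists_isRepetition
  exact hφ.2.2 s f hf

theorem sum_succ_mul_pow_le {x : ℝ} (hx₀ : 0 ≤ x) (hx₁ : x < 1) (n : ℕ) :
    ∑ s ∈ range n, ((s : ℝ) + 1) * x ^ s ≤ 1 / (1 - x) ^ 2 := by
  have h : (∑ s ∈ range n, ((s : ℝ) + 1) * x ^ s) * (1 - x) ^ 2 =
      1 - x ^ n * (1 + n * (1 - x)) := by
    induction n with
    | zero => simp
    | succ n ih =>
      rw [sum_range_succ, add_mul, ih]
      push_cast
      ring
  have hx : 0 < 1 - x := by linarith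
  rw [le_div_iff₀ (by positivity), h]
  have : 0 ≤ x ^ n * (1 + n * (1 - x)) := by positivity
  linarith

/-- The counting bound with growth rate `β = r * Δ ^ 2`. -/
theorem nonrepetitivelyChoosable_of_le {k : ℕ} {r : ℝ} (hr : 1 < r) (hΔ : 1 ≤ G.maxDegree)
    (hk : r * (G.maxDegree : ℝ) ^ 2 + G.maxDegree * (r / (r - 1)) ^ 2 ≤ k) :
    NonrepetitivelyChoosable.{u, w} G k := by
  have hΔ' : (0 : ℝ) < G.maxDegree := by exact_mod_cast hΔ
  have hr₀ : 0 < r := by linarith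
  have hr₁ : r - 1 ≠ 0 := by linarith
  refine nonrepetitivelyChoosable_of_sum_le (β := r * (G.maxDegree : ℝ) ^ 2) (by positivity)
    (le_trans (add_le_add_right ?_ _) hk)
  have hterm : ∀ s : ℕ, ((s : ℝ) + 1) *
      ((G.maxDegree : ℝ) ^ (2 * s + 1) / (r * (G.maxDegree : ℝ) ^ 2) ^ s) =
      G.maxDegree * (((s : ℝ) + 1) * r⁻¹ ^ s) := fun s => by
    rw [mul_pow, ← pow_mul, pow_succ, inv_pow]
    field_simp
  rw [sum_congr rfl fun s _ => hterm s, ← mul_sum]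
  gcongr
  refine (sum_succ_mul_pow_le (by positivity) (inv_lt_one_of_one_lt₀ hr) _).trans (le_of_eq ?_)
  have : 1 - r⁻¹ = (r - 1) / r := by field_simp
  rw [this, div_pow, div_pow, one_div_div]

end ChoiceNumber

/-- The bound on the nonrepetitive choice number, as a multiple of `Δ ^ 2`. -/
noncomputable def choiceRatio (Δ : ℕ) : ℝ :=
  1 + 1 / ((Δ : ℝ) ^ ((1 : ℝ) / 3) - 1) + 1 / (Δ : ℝ) ^ ((1 : ℝ) / 3)

theorem nonrepetitivelyChoosable_ceil {V : Type u} [Fintype V] {G : SimpleGraph V}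
    [DecidableRel G.Adj] (hΔ : 1 < G.maxDegree) :
    NonrepetitivelyChoosable.{u, w} G ⌈choiceRatio G.maxDegree * (G.maxDegree : ℝ) ^ 2⌉₊ := by
  have hΔ' : (1 : ℝ) < G.maxDegree := by exact_mod_cast hΔ
  set a : ℝ := (G.maxDegree : ℝ) ^ ((1 : ℝ) / 3) with ha
  have ha₁ : 1 < a := Real.one_lt_rpow hΔ' (by norm_num)
  have ha₂ : 0 < a - 1 := by linarith
  have hpow : (G.maxDegree : ℝ) = a ^ 3 := by
    rw [ha, ← Real.rpow_natCast, ← Real.rpow_mul (by positivity)]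
    norm_num
  -- This `r` balances the two error terms: `r / (r - 1) = Δ ^ (1 / 3)`.
  refine nonrepetitivelyChoosable_of_le (r := 1 + 1 / (a - 1)) (by simpa using ha₂) hΔ.le
    (le_trans (le_of_eq ?_) (Nat.le_ceil _))
  rw [choiceRatio, ← ha, hpow]
  field_simp
  ring

/-- The error function: the excess of `choiceRatio Δ` over `1`, plus `1 / Δ ^ 2` for the rounding.
At `Δ = 1`, where `choiceRatio` has a vanishing denominator, the value `5` matches
the bound `6` on the choice number. -/
noncomputable def choiceError (Δ : ℕ) : ℝ :=
  if Δ = 1 then 5 else choiceRatio Δ - 1 + 1 / (Δ : ℝ) ^ 2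

theorem tendsto_choiceError : Tendsto choiceError atTop (𝓝 0) := by
  have hroot : Tendsto (fun Δ : ℕ => (Δ : ℝ) ^ ((1 : ℝ) / 3)) atTop atTop :=
    (tendsto_rpow_atTop (by norm_num)).comp tendsto_natCast_atTop_atTop
  have h₁ := (tendsto_atTop_add_const_right _ (-1) hroot).inv_tendsto_atTop
  have h₂ := hroot.inv_tendsto_atTop
  have h₃ := ((tendsto_pow_atTop (α := ℝ) two_ne_zero).comp
    (tendsto_natCast_atTop_atTop (R := ℝ))).inv_tendsto_atTop
  have h := (h₁.add h₂).add h₃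
  rw [add_zero, add_zero] at h
  refine h.congr' ?_
  filter_upwards [eventually_gt_atTop 1] with Δ hΔ
  rw [choiceError, if_neg hΔ.ne', choiceRatio]
  simp only [Pi.inv_apply, Function.comp_apply, one_div, sub_eq_add_neg]
  ring

theorem exists_choosable_le_choiceError {V : Type u} [Fintype V] {G : SimpleGraph V}
    [DecidableRel G.Adj] (hΔ : 1 ≤ G.maxDegree) :
    ∃ k : ℕ, NonrepetitivelyChoosable.{u, w} G k ∧
      (k : ℝ) ≤ (1 + choiceError G.maxDegree) * (G.maxDegree : ℝ) ^ 2 := by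
  rcases hΔ.eq_or_lt with h | h
  · refine ⟨6, nonrepetitivelyChoosable_of_le (r := 2) (by norm_num) hΔ ?_, ?_⟩ <;>
      norm_num [← h, choiceError]
  · refine ⟨_, nonrepetitivelyChoosable_ceil h, ?_⟩
    have hΔ' : (1 : ℝ) < G.maxDegree := by exact_mod_cast h
    have hnonneg : 0 ≤ choiceRatio G.maxDegree := by
      have : 1 < (G.maxDegree : ℝ) ^ ((1 : ℝ) / 3) := Real.one_lt_rpow hΔ' (by norm_num)
      have : 0 < (G.maxDegree : ℝ) ^ ((1 : ℝ) / 3) - 1 := by linarith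
      rw [choiceRatio]
      positivity
    refine (Nat.ceil_lt_add_one (by positivity)).le.trans (le_of_eq ?_)
    rw [choiceError, if_neg h.ne']
    field_simp
    ring

end SimpleGraph

theorem mainTheorem1 :
    (∀ (V : Type u) [Fintype V] (G : SimpleGraph V) [DecidableRel G.Adj],
      1 < G.maxDegree →
        SimpleGraph.nonrepetitiveChoiceNumber.{u, w} G ≤
          ((⌈(1 + 1 / ((G.maxDegree : ℝ) ^ ((1 : ℝ) / 3) - 1)
              + 1 / (G.maxDegree : ℝ) ^ ((1 : ℝ) / 3)) * (G.maxDegree : ℝ) ^ 2⌉₊ : ℕ) : ℕ∞)) ∧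
    (∃ ε : ℕ → ℝ, Tendsto ε atTop (𝓝 0) ∧
      ∀ (V : Type u) [Fintype V] (G : SimpleGraph V) [DecidableRel G.Adj],
        1 ≤ G.maxDegree →
          ∃ k : ℕ, SimpleGraph.nonrepetitiveChoiceNumber.{u, w} G = (k : ℕ∞) ∧
            (k : ℝ) ≤ (1 + ε G.maxDegree) * (G.maxDegree : ℝ) ^ 2) := by

  refine ⟨fun V _ G _ hΔ =>
    (SimpleGraph.nonrepetitivelyChoosable_ceil hΔ).nonrepetitiveChoiceNumber_le,
    SimpleGraph.choiceError, SimpleGraph.tendsto_choiceError, fun V _ G _ hΔ => ?_⟩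
  obtain ⟨k, hk, hle⟩ := SimpleGraph.exists_choosable_le_choiceError.{u, w} (G := G) hΔ
  have hnum := hk.nonrepetitiveChoiceNumber_le
  obtain ⟨m, hm⟩ := ENat.ne_top_iff_exists.1 (ne_top_of_le_ne_top (ENat.natCast_ne_top k) hnum)
  refine ⟨m, hm.symm, le_trans ?_ hle⟩
  rw [← hm] at hnum
  exact_mod_cast hnum
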